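/- Let $\mathbb{P}$ be the Wiener measure on $\Omega=C([0,\infty),\mathbb{R}^3)$, i.e. the law of a three-dimensional standard Brownian motion $W=(W_t)_{t\ge 0}$ started at the origin. For $t>0$ let $$L_t=\frac1t\int_0^t \delta_{W_s}\,ds$$ be the normalized occupation measure of $W$ up to time $t$, and let $$\Lambda_t(x)=\int_{\mathbb{R}^3}\frac{L_t(dy)}{|x-y|}=\frac1t\int_0^t\frac{ds}{|W_s-x|}\in[0,\infty],\qquad x\in\mathbb{R}^3,$$ be its Coulomb functional (with $1/0=\infty$), and $\|\Lambda_t\|_\infty=\sup_{x\in\mathbb{R}^3}\Lambda_t(x)$. Then for every $b>0$, $$\limsup_{t\to\infty}\frac1t\log\mathbb{P}\big\{\|\Lambda_t\|_\infty>b\big\}<0,$$ where $\log 0=-\infty$. -/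

import Mathlib

open MeasureTheory ProbabilityTheory Filter
open scoped ENNReal NNReal

namespace BrownianCoulomb

/-- Three-dimensional Euclidean space. -/
abbrev E3 : Type := EuclideanSpace ℝ (Fin 3)

/-- The path space `C([0,∞), ℝ³)`. -/
abbrev PathSpace : Type := C(ℝ≥0, E3)

/-- The σ-algebra on the path space generated by the coordinate maps `ω ↦ ω t`, `t ≥ 0`
(it is the Borel σ-algebra of locally uniform convergence). -/
instance instMeasurableSpacePathSpace : MeasurableSpace PathSpace :=
  ⨆ t : ℝ≥0, MeasurableSpace.comap (fun ω : PathSpace => ω t) inferInstance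

/-- A three-dimensional standard Brownian motion started at the origin: the three coordinate
processes are independent standard one-dimensional Brownian motions started at `0`. -/
structure IsBrownianMotion3 {Ω : Type*} [MeasurableSpace Ω] (W : ℝ≥0 → Ω → E3)
    (P : Measure Ω) : Prop where
  coord : ∀ i : Fin 3, IsBrownianReal (fun t ω => W t ω i) P
  indep : iIndepFun (fun (i : Fin 3) (ω : Ω) (t : ℝ≥0) => W t ω i) P

/-- `P` is the Wiener measure on `C([0,∞), ℝ³)`: under `P`, the canonical process
`W_t(ω) = ω t` is a three-dimensional standard Brownian motion started at the origin. -/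
def IsWienerMeasure (P : Measure PathSpace) : Prop :=
  IsBrownianMotion3 (fun (t : ℝ≥0) (ω : PathSpace) => ω t) P

/-- The normalized occupation measure `L_t = (1/t) ∫₀ᵗ δ_{ω s} ds` of the path `ω` up to
time `t > 0`. -/
noncomputable def occupationMeasure (ω : PathSpace) (t : ℝ) : Measure E3 :=
  (ENNReal.ofReal t)⁻¹ •
    Measure.map (fun s : ℝ => ω s.toNNReal) (volume.restrict (Set.Icc 0 t))

/-- The Coulomb functional `(Λμ)(x) = ∫ μ(dy) / |x - y|`, with values in `[0, ∞]`;
here `1 / 0 = ∞`. -/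
noncomputable def coulomb (μ : Measure E3) (x : E3) : ℝ≥0∞ :=
  ∫⁻ y, (‖x - y‖ₑ)⁻¹ ∂μ

/-- `Λ_t(x) = (Λ L_t)(x)`. -/
noncomputable def Lambda (ω : PathSpace) (t : ℝ) (x : E3) : ℝ≥0∞ :=
  coulomb (occupationMeasure ω t) x

/-- `‖Λ_t‖_∞`, the supremum of `Λ_t(x)` over all `x ∈ ℝ³`. -/
noncomputable def supNorm (ω : PathSpace) (t : ℝ) : ℝ≥0∞ :=
  ⨆ x : E3, Lambda ω t x

end BrownianCoulomb

namespace BrownianCoulomb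

/-! The kernel `1/|y|` is dominated by its cutoff value at distance `R = 2/b`, which contributes at
most `b/2`, plus a dyadic sum of bumps of radius `R/2^k` with weights of order `2^k/R`. If the
supremum exceeds `b`, then at some scale `k` the path spends more than `(t/8)(3/8)^k` near some
point `x` (`exists_occupation_of_lt_supNorm`).

At a fixed scale `r`, Khasminskii's argument bounds exponential moments of occupation times. In
dimension three the expected time spent in a ball of radius `r` is of order `r^2`, so with `a` of
order `r^{-2}` the Markov property gives `K ≤ 1 + K/2` for the worst exponential moment `K`, hence
`K ≤ 2`, uniformly in `t` (`lintegral_expOcc_le`).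

Uniformity over the uncountably many centres `x` comes from expanding the exponential over the times
at which the path is near `x`: from such a time on, closeness to `x` implies closeness to the
present position of the path. This bounds every centre by a single measurable variable of mean at
most `1 + 2at` (`exp_occupation_le`), to which Markov's inequality applies.

With `a` of order `4^k`, the exponent at scale `k` is `αt(3/2)^k`. It beats the prefactor `4^k`, so
the union bound over scales is summable and decays exponentially in `t`. -/

/-! ### Measurability on path space. -/

lemma measurable_eval (t : ℝ≥0) : Measurable (fun ω : PathSpace => ω t) :=
  measurable_iff_comap_le.2 (le_iSup (fun t : ℝ≥0 =>
    MeasurableSpace.comap (fun ω : PathSpace => ω t) inferInstance) t)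

lemma measurable_pathSpace {α : Type*} {m : MeasurableSpace α} {f : α → PathSpace}
    (h : ∀ t, Measurable fun a => f a t) : Measurable f := by
  rw [measurable_iff_comap_le, instMeasurableSpacePathSpace, MeasurableSpace.comap_iSup]
  refine iSup_le fun t => ?_
  rw [MeasurableSpace.comap_comp]
  exact measurable_iff_comap_le.1 (h t)

lemma measurable_eval_coord (t : ℝ≥0) (i : Fin 3) : Measurable (fun ω : PathSpace => ω t i) := by
  exact (by fun_prop : Measurable fun x : E3 => x i).comp (measurable_eval t)

lemma measurable_eval_uncurry : Measurable (fun p : PathSpace × ℝ≥0 => p.1 p.2) := by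
  have h : Measurable (Function.uncurry fun (t : ℝ≥0) (ω : PathSpace) => ω t) :=
    measurable_uncurry_of_continuous_of_measurable (fun ω => ω.continuous) measurable_eval
  exact h.comp measurable_swap

/-- The path of increments after time `u`. -/
def shiftPath (u : ℝ≥0) (ω : PathSpace) : PathSpace where
  toFun τ := ω (u + τ) - ω u
  continuous_toFun := by fun_prop

@[simp] lemma shiftPath_apply (u τ : ℝ≥0) (ω : PathSpace) :
    shiftPath u ω τ = ω (u + τ) - ω u := rfl

lemma measurable_shiftPath (u : ℝ≥0) : Measurable (shiftPath u) :=
  measurable_pathSpace fun t => (measurable_eval (u + t)).sub (measurable_eval u)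

/-! ### Independence of past and future increments. -/

lemma iIndepFun_bool_of_indepFun {Ω : Type*} {β : Bool → Type*} {mΩ : MeasurableSpace Ω}
    {m : ∀ i, MeasurableSpace (β i)} {μ : Measure Ω} [IsProbabilityMeasure μ]
    {f : ∀ i, Ω → β i} (h : IndepFun (f true) (f false) μ) : iIndepFun f μ := by
  rw [iIndepFun_iff_measure_inter_preimage_eq_mul]
  rw [indepFun_iff_measure_inter_preimage_eq_mul] at h
  intro S sets hS
  have key : ∀ S : Finset Bool, S = ∅ ∨ S = {true} ∨ S = {false} ∨ S = {true, false} := by decide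
  rcases key S with rfl | rfl | rfl | rfl
  · simp
  · simp
  · simp
  · rw [Finset.set_biInter_insert, Finset.set_biInter_singleton, Finset.prod_pair (by decide)]
    exact h (sets true) (sets false) (hS true (by simp)) (hS false (by simp))

variable {P : Measure PathSpace}

lemma IsWienerMeasure.isProbabilityMeasure (hP : IsWienerMeasure P) : IsProbabilityMeasure P :=
  ((hP.coord 0).hasLaw_eval 0).isProbabilityMeasure

/-- **Weak Markov property**, in coordinates. -/
lemma IsWienerMeasure.indepFun_coord (hP : IsWienerMeasure P) (u : ℝ≥0) :
    IndepFun (fun (ω : PathSpace) (i : Fin 3) (τ : ℝ≥0) => ω (u + τ) i - ω u i)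
      (fun (ω : PathSpace) (i : Fin 3) (v : ℝ≥0) => ω (min v u) i) P := by
  have := hP.isProbabilityMeasure
  let X : Fin 3 → Bool → PathSpace → ℝ≥0 → ℝ := fun i j ω =>
    if j then fun τ => ω (u + τ) i - ω u i else fun v => ω (min v u) i
  have mX : ∀ i j, Measurable (X i j) := by
    intro i j
    have h := fun t => measurable_eval_coord t i
    cases j
    · exact measurable_pi_lambda _ fun t => h _
    · exact measurable_pi_lambda _ fun t => (h _).sub (h _)
  have h1 : iIndepFun (fun i ω => (X i · ω)) P := by
    refine hP.indep.comp (fun i (x : ℝ≥0 → ℝ) (j : Bool) =>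
      if j then fun τ => x (u + τ) - x u else fun v => x (min v u)) fun i => ?_
    refine measurable_pi_lambda _ fun j => ?_
    cases j
    · exact measurable_pi_lambda _ fun t => measurable_pi_apply _
    · exact measurable_pi_lambda _ fun t => (measurable_pi_apply _).sub (measurable_pi_apply _)
  have h2 : ∀ i, iIndepFun (X i) P := by
    intro i
    refine iIndepFun_bool_of_indepFun ?_
    have h := (hP.coord i).indepFun_shift u
    exact h.comp (φ := id)
      (ψ := fun (x : Set.Iic u → ℝ) (v : ℝ≥0) => x ⟨min v u, Set.mem_Iic.2 (min_le_right v u)⟩)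
      measurable_id (measurable_pi_lambda _ fun t =>
        measurable_pi_apply (⟨min t u, Set.mem_Iic.2 (min_le_right t u)⟩ : Set.Iic u))
  -- Independence across coordinates and between past and future within each coordinate make all six
  -- blocks independent; they are then regrouped into three futures and three pasts.
  have h3 := (iIndepFun_uncurry' mX h1 h2).indepFun_finset
    (Finset.univ.filter fun p => p.2 = true) (Finset.univ.filter fun p => p.2 = false)
    (by decide) (fun p => mX p.1 p.2)
  exact h3.comp
    (φ := fun x (i : Fin 3) => x ⟨(i, true), by simp⟩)
    (ψ := fun x (i : Fin 3) => x ⟨(i, false), by simp⟩)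
    (measurable_pi_lambda _ fun t => measurable_pi_apply _)
    (measurable_pi_lambda _ fun t => measurable_pi_apply _)

/-- **Weak Markov property**: the increments after time `u` are independent of those before. -/
lemma IsWienerMeasure.indepFun_increment (hP : IsWienerMeasure P) {s u : ℝ≥0} (hsu : s ≤ u) :
    IndepFun (fun ω : PathSpace => ω u - ω s) (shiftPath u) P := by
  have h := (hP.indepFun_coord u).symm
  have h1 := h.comp
    (φ := fun x => (WithLp.toLp 2 fun i => x i u - x i s : E3))
    (ψ := fun x (τ : ℝ≥0) => (WithLp.toLp 2 fun i => x i τ : E3))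
    (by fun_prop) (by fun_prop)
  have e1 : (fun ω : PathSpace => ω u - ω s) = (fun x : Fin 3 → ℝ≥0 → ℝ =>
      (WithLp.toLp 2 fun i => x i u - x i s : E3)) ∘
        (fun (ω : PathSpace) (i : Fin 3) (v : ℝ≥0) => ω (min v u) i) := by
    ext ω i; simp [hsu]
  rw [← e1, IndepFun_iff_Indep] at h1
  rw [IndepFun_iff_Indep]
  -- The σ-algebra on path space is generated by evaluations, so that of `shiftPath u` lies inside
  -- the one generated by the coordinatewise increments.
  refine indep_of_indep_of_le_right h1 ?_
  rw [← measurable_iff_comap_le]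
  refine measurable_pathSpace fun t => ?_
  exact (measurable_pi_apply t).comp (comap_measurable
    ((fun (x : Fin 3 → ℝ≥0 → ℝ) (τ : ℝ≥0) => (WithLp.toLp 2 fun i => x i τ : E3)) ∘
      fun (ω : PathSpace) (i : Fin 3) (τ : ℝ≥0) => ω (u + τ) i - ω u i))

/-! ### Small ball probabilities. -/

/-- The density is at most `1/√(2πv) ≤ 1/(2√v)`, and the interval has length `2r`. -/
lemma gaussianReal_ball_le {v : ℝ≥0} (hv : v ≠ 0) (y r : ℝ) :
    gaussianReal 0 v {z | |y + z| < r} ≤ ENNReal.ofReal (r / √v) := by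
  have hpos : (0 : ℝ) < v := by positivity
  have hs : {z : ℝ | |y + z| < r} = Metric.ball (-y) r := by
    ext z; simp [Real.dist_eq, add_comm]
  rw [gaussianReal_apply _ hv, hs]
  have hpdf : ∀ x, gaussianPDF 0 v x ≤ ENNReal.ofReal (1 / (2 * √v)) := by
    intro x
    refine ENNReal.ofReal_le_ofReal ?_
    rw [gaussianPDFReal]
    have h1 : Real.exp (-(x - 0) ^ 2 / (2 * v)) ≤ 1 := by
      rw [Real.exp_le_one_iff]
      exact div_nonpos_of_nonpos_of_nonneg (by nlinarith [sq_nonneg (x - 0)]) (by positivity)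
    have h2 : 2 * √v ≤ √(2 * Real.pi * v) := by
      refine Real.le_sqrt_of_sq_le ?_
      rw [mul_pow, Real.sq_sqrt hpos.le]
      nlinarith [Real.pi_gt_three]
    calc (√(2 * Real.pi * v))⁻¹ * Real.exp (-(x - 0) ^ 2 / (2 * v))
        ≤ (√(2 * Real.pi * v))⁻¹ * 1 := by gcongr
      _ ≤ 1 / (2 * √v) := by
        rw [mul_one, one_div]
        exact inv_anti₀ (by positivity) h2
  calc ∫⁻ x in Metric.ball (-y) r, gaussianPDF 0 v x
      ≤ ∫⁻ x in Metric.ball (-y) r, ENNReal.ofReal (1 / (2 * √v)) := lintegral_mono fun x => hpdf x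
    _ = ENNReal.ofReal (1 / (2 * √v)) * ENNReal.ofReal (2 * r) := by
      rw [setLIntegral_const, Real.volume_ball]
    _ = ENNReal.ofReal (r / √v) := by
      rw [← ENNReal.ofReal_mul (by positivity)]
      congr 1
      field_simp

/-- Small ball estimate for the increments of Brownian motion. -/
lemma IsWienerMeasure.increment_ball_le (hP : IsWienerMeasure P) {s u : ℝ≥0} (hsu : s < u)
    (y : E3) {r : ℝ} (hr : 0 < r) :
    P {ω | ‖ω u - ω s + y‖ < r} ≤ ENNReal.ofReal ((r / √((u : ℝ) - s)) ^ 3) := by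
  let Y : Fin 3 → PathSpace → ℝ := fun i ω => ω u i - ω s i
  have hY : iIndepFun Y P := hP.indep.comp (fun i (x : ℝ≥0 → ℝ) => x u - x s) fun i =>
    (measurable_pi_apply _).sub (measurable_pi_apply _)
  have hsub : {ω : PathSpace | ‖ω u - ω s + y‖ < r} ⊆
      ⋂ i ∈ Finset.univ, Y i ⁻¹' {z | |y i + z| < r} := by
    intro ω hω
    simp only [Finset.mem_univ, Set.iInter_true, Set.mem_iInter, Set.mem_preimage,
      Set.mem_ofPred_eq]
    intro i
    have := (PiLp.norm_apply_le (ω u - ω s + y) i).trans_lt hω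
    simpa [Y, add_comm] using this
  have hm : ∀ i : Fin 3, MeasurableSet {z : ℝ | |y i + z| < r} := fun i =>
    measurableSet_lt (by fun_prop) measurable_const
  have hd : (nndist (u : ℝ) (s : ℝ) : ℝ) = (u : ℝ) - s := by
    rw [coe_nndist, Real.dist_eq, abs_of_pos]
    exact sub_pos.2 (by exact_mod_cast hsu)
  have hd0 : nndist (u : ℝ) (s : ℝ) ≠ 0 := by
    rw [Ne, nndist_eq_zero]; exact_mod_cast hsu.ne'
  calc P {ω | ‖ω u - ω s + y‖ < r}
      ≤ P (⋂ i ∈ Finset.univ, Y i ⁻¹' {z | |y i + z| < r}) := measure_mono hsub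
    _ = ∏ i : Fin 3, P (Y i ⁻¹' {z | |y i + z| < r}) :=
      hY.measure_inter_preimage_eq_mul _ (fun i _ => hm i)
    _ ≤ ∏ i : Fin 3, ENNReal.ofReal (r / √((u : ℝ) - s)) := by
      refine Finset.prod_le_prod' fun i _ => ?_
      have hl := (hP.coord i).hasLaw_sub u s
      have hmY : Measurable (Y i) := (measurable_eval_coord u i).sub (measurable_eval_coord s i)
      have : P (Y i ⁻¹' {z | |y i + z| < r}) =
          gaussianReal 0 (nndist (u : ℝ) (s : ℝ)) {z | |y i + z| < r} := by
        rw [← Measure.map_apply hmY (hm i)]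
        exact congrArg (fun μ : Measure ℝ => μ _) hl.map_eq
      rw [this, ← hd]
      exact gaussianReal_ball_le hd0 _ _
    _ = ENNReal.ofReal ((r / √((u : ℝ) - s)) ^ 3) := by
      rw [Finset.prod_const, ENNReal.ofReal_pow (by positivity)]
      rfl

/-! ### Cutoffs and exponential occupation functionals. -/

/-- A continuous cutoff, equal to `1` on the ball of radius `r` and to `0` off the ball of
radius `2 * r`. -/
noncomputable def bump (r : ℝ) (y : E3) : ℝ := max 0 (min 1 (2 - ‖y‖ / r))

lemma continuous_bump (r : ℝ) : Continuous (bump r) := by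
  unfold bump; fun_prop

lemma bump_nonneg (r : ℝ) (y : E3) : 0 ≤ bump r y := le_max_left _ _

lemma bump_le_one (r : ℝ) (y : E3) : bump r y ≤ 1 := max_le zero_le_one (min_le_left _ _)

lemma bump_eq_one {r : ℝ} (hr : 0 < r) {y : E3} (hy : ‖y‖ ≤ r) : bump r y = 1 := by
  have : ‖y‖ / r ≤ 1 := (div_le_one hr).2 hy
  rw [bump, min_eq_left (by linarith), max_eq_right zero_le_one]

lemma norm_lt_of_bump_ne_zero {r : ℝ} (hr : 0 < r) {y : E3} (hy : bump r y ≠ 0) :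
    ‖y‖ < 2 * r := by
  by_contra! h
  have : 2 ≤ ‖y‖ / r := (le_div_iff₀ hr).2 h
  exact hy (max_eq_left ((min_le_right _ _).trans (by linarith)))

/-- Two points within `2r` of `x` are within `4r` of each other, where the wider bump equals `1`.
This replaces an arbitrary centre `x` by a point of the path. -/
lemma bump_le_bump_sub {r : ℝ} (hr : 0 < r) {x y z : E3} (hy : bump r (y - x) ≠ 0) :
    bump r (z - x) ≤ bump (4 * r) (z - y) := by
  rcases eq_or_ne (bump r (z - x)) 0 with h | h
  · rw [h]; exact bump_nonneg _ _
  · rw [bump_eq_one (r := 4 * r) (y := z - y) (by positivity)]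
    · exact bump_le_one _ _
    · have h1 := norm_lt_of_bump_ne_zero hr hy
      have h2 := norm_lt_of_bump_ne_zero hr h
      calc ‖z - y‖ = ‖(z - x) - (y - x)‖ := by congr 1; abel
        _ ≤ ‖z - x‖ + ‖y - x‖ := norm_sub_le _ _
        _ ≤ 4 * r := by linarith

/-- The integrand is minus the derivative of `exp (∫ u in u..t, v)`. The remaining exponential
involves only times after `u`, which is the form needed for the Markov property at time `u`. -/
lemma exp_integral_eq {v : ℝ → ℝ} (hv : Continuous v) (s t : ℝ) :
    Real.exp (∫ u in s..t, v u) =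
      1 + ∫ u in s..t, v u * Real.exp (∫ u' in u..t, v u') := by
  have hd : ∀ u, HasDerivAt (fun u => Real.exp (∫ u' in u..t, v u'))
      (-(v u * Real.exp (∫ u' in u..t, v u'))) u := by
    intro u
    have h := (intervalIntegral.integral_hasDerivAt_left (hv.intervalIntegrable u t)
      (hv.stronglyMeasurableAtFilter _ _) hv.continuousAt).exp
    convert h using 1
    ring
  have hc : Continuous fun u => v u * Real.exp (∫ u' in u..t, v u') :=
    hv.mul (continuous_iff_continuousAt.2 fun u => (hd u).continuousAt)
  have h := intervalIntegral.integral_eq_sub_of_hasDerivAt (fun u _ => hd u)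
    (hc.neg.intervalIntegrable s t)
  rw [intervalIntegral.integral_neg, intervalIntegral.integral_same, Real.exp_zero] at h
  linarith

lemma continuous_exp_integral {v : ℝ → ℝ} (hv : Continuous v) (t : ℝ) :
    Continuous fun u => Real.exp (∫ u' in u..t, v u') := by
  refine continuous_iff_continuousAt.2 fun u => ?_
  exact ((intervalIntegral.integral_hasDerivAt_left (hv.intervalIntegrable u t)
      (hv.stronglyMeasurableAtFilter _ _) hv.continuousAt).exp).continuousAt

lemma measurable_intervalIntegral_left {α : Type*} {m : MeasurableSpace α} {f : α → ℝ → ℝ}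
    (hf : Measurable (Function.uncurry f)) {l : α → ℝ} (hl : Measurable l) (t : ℝ) :
    Measurable fun p => ∫ u in l p..t, f p u := by
  have key : ∀ S : α → Set ℝ, MeasurableSet {q : α × ℝ | q.2 ∈ S q.1} →
      (∀ p, MeasurableSet (S p)) → Measurable fun p => ∫ u in S p, f p u := by
    intro S hS hS'
    have : (fun p => ∫ u in S p, f p u) =
        fun p => ∫ u, Set.indicator {q : α × ℝ | q.2 ∈ S q.1} (Function.uncurry f) (p, u) := by
      ext p
      rw [← integral_indicator (hS' p)]
      rfl
    rw [this]
    exact ((hf.indicator hS).stronglyMeasurable.integral_prod_right').measurable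
  refine (key _ ?_ fun p => measurableSet_Ioc).sub (key _ ?_ fun p => measurableSet_Ioc)
  · exact (measurableSet_lt (hl.comp measurable_fst) measurable_snd).inter
      (measurableSet_le measurable_snd measurable_const)
  · exact (measurableSet_lt measurable_const measurable_snd).inter
      (measurableSet_le measurable_snd (hl.comp measurable_fst))

/-- The exponential functional of the time spent near `-y` by `ω - ω s` during `[s, t]`. -/
noncomputable def expOcc (a r t s : ℝ) (y : E3) (ω : PathSpace) : ℝ :=
  Real.exp (∫ u in s..t, a * bump r (ω u.toNNReal - ω s.toNNReal + y))

lemma continuous_path (ω : PathSpace) : Continuous fun u : ℝ => ω u.toNNReal := by fun_prop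

lemma expOcc_nonneg (a r t s : ℝ) (y : E3) (ω : PathSpace) : 0 ≤ expOcc a r t s y ω :=
  (Real.exp_pos _).le

lemma continuous_occ_integrand (a r s : ℝ) (y : E3) (ω : PathSpace) :
    Continuous fun u : ℝ => a * bump r (ω u.toNNReal - ω s.toNNReal + y) := by
  have := continuous_bump r
  fun_prop

lemma expOcc_le {a : ℝ} (ha : 0 ≤ a) (r : ℝ) {t s : ℝ} (hs : 0 ≤ s) (hst : s ≤ t) (y : E3)
    (ω : PathSpace) : expOcc a r t s y ω ≤ Real.exp (a * t) := by
  refine Real.exp_le_exp.2 ?_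
  calc ∫ u in s..t, a * bump r (ω u.toNNReal - ω s.toNNReal + y)
      ≤ ∫ _ in s..t, a :=
        intervalIntegral.integral_mono_on hst ((continuous_occ_integrand a r s y ω).intervalIntegrable _ _)
          (by simp) fun u _ => mul_le_of_le_one_right ha (bump_le_one _ _)
    _ = (t - s) * a := by simp
    _ ≤ a * t := by nlinarith

lemma measurable_path_eval {α : Type*} {m : MeasurableSpace α} {f : α → PathSpace} {g : α → ℝ}
    (hf : Measurable f) (hg : Measurable g) : Measurable fun p => f p (g p).toNNReal :=
  measurable_eval_uncurry.comp (hf.prodMk hg.real_toNNReal)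

lemma measurable_expOcc {α : Type*} {m : MeasurableSpace α} (a r t : ℝ) {s : α → ℝ} {y : α → E3}
    {ω : α → PathSpace} (hs : Measurable s) (hy : Measurable y) (hω : Measurable ω) :
    Measurable fun p => expOcc a r t (s p) (y p) (ω p) := by
  unfold expOcc
  refine Real.measurable_exp.comp (measurable_intervalIntegral_left ?_ hs t)
  have h1 := measurable_path_eval (hω.comp measurable_fst) (measurable_snd (α := α) (β := ℝ))
  have h2 : Measurable fun p : α × ℝ => ω p.1 (s p.1).toNNReal :=
    measurable_path_eval (hω.comp measurable_fst) (hs.comp measurable_fst)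
  exact ((continuous_bump r).measurable.comp
    ((h1.sub h2).add (hy.comp measurable_fst))).const_mul a

/-- Exponential occupation functionals near an arbitrary point are controlled, uniformly in the
point, by those near the points of the path. -/
lemma exp_occupation_le {a r t : ℝ} (ha : 0 ≤ a) (hr : 0 < r) (ht : 0 ≤ t) (ω : PathSpace)
    (x : E3) :
    ENNReal.ofReal (Real.exp (∫ s in (0 : ℝ)..t, a * bump r (ω s.toNNReal - x))) ≤
      1 + ENNReal.ofReal a * ∫⁻ s in Set.Ioc 0 t, ENNReal.ofReal (expOcc a (4 * r) t s 0 ω) := by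
  have hb := continuous_bump r
  have hv : Continuous fun s : ℝ => a * bump r (ω s.toNNReal - x) := by fun_prop
  have hF := continuous_exp_integral hv t
  have hF' := hv.mul hF
  rw [exp_integral_eq hv, ENNReal.ofReal_add zero_le_one, ENNReal.ofReal_one,
    intervalIntegral.integral_of_le ht, ofReal_integral_eq_lintegral_ofReal]
  · refine add_le_add_right ?_ 1
    rw [← lintegral_const_mul' _ _ ENNReal.ofReal_ne_top]
    refine setLIntegral_mono' measurableSet_Ioc fun s hs => ?_
    rw [← ENNReal.ofReal_mul ha]
    refine ENNReal.ofReal_le_ofReal ?_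
    -- Only times `s` at which the path is near `x` contribute, and from then on `ω s` can serve as
    -- the centre.
    rcases eq_or_ne (bump r (ω s.toNNReal - x)) 0 with h | h
    · rw [h, mul_zero, zero_mul]
      exact mul_nonneg ha (expOcc_nonneg _ _ _ _ _ _)
    · refine mul_le_mul (mul_le_of_le_one_right ha (bump_le_one _ _)) ?_ (Real.exp_pos _).le ha
      refine Real.exp_le_exp.2 (intervalIntegral.integral_mono_on hs.2
        (hv.intervalIntegrable _ _)
        ((continuous_occ_integrand a (4 * r) s 0 ω).intervalIntegrable _ _) fun u _ => ?_)
      rw [add_zero]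
      exact mul_le_mul_of_nonneg_left (bump_le_bump_sub hr h) ha
  · exact (hF'.integrableOn_Icc).mono_set Set.Ioc_subset_Icc_self
  · exact Eventually.of_forall fun s => mul_nonneg (mul_nonneg ha (bump_nonneg _ _)) (Real.exp_pos _).le
  · exact intervalIntegral.integral_nonneg ht fun s _ =>
      mul_nonneg (mul_nonneg ha (bump_nonneg _ _)) (Real.exp_pos _).le

/-! ### Khasminskii's lemma. -/

/-- The integral over time of the small ball bound. -/
lemma lintegral_min_one_le {c : ℝ} (hc : 0 < c) (s t : ℝ) :
    ∫⁻ u in Set.Ioc s t, min 1 (ENNReal.ofReal ((c / √(u - s)) ^ 3)) ≤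
      ENNReal.ofReal (3 * c ^ 2) := by
  have hc2 : 0 < c ^ 2 := by positivity
  let h : ℝ → ℝ≥0∞ := fun v => min 1 (ENNReal.ofReal ((c / √v) ^ 3))
  have hrpow : ∀ v ∈ Set.Ioi (c ^ 2), (c / √v) ^ 3 = c ^ 3 * v ^ (-(3 / 2) : ℝ) := by
    intro v hv
    have hv0 : 0 < v := hc2.trans hv
    rw [div_pow, div_eq_mul_inv, Real.rpow_neg hv0.le, Real.sqrt_eq_rpow, ← Real.rpow_natCast,
      ← Real.rpow_natCast, ← Real.rpow_mul hv0.le]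
    norm_num
  -- The two bounds cross at `v = c^2`: the constant `1` gives `c^2` below, and the tail of `c^3
  -- v^(-3/2)`, integrable because the dimension is three, gives `2c^2` above.
  have hsplit : ∫⁻ v in Set.Ioi 0, h v ≤ ENNReal.ofReal (3 * c ^ 2) := by
    rw [← Set.Ioc_union_Ioi_eq_Ioi hc2.le,
      lintegral_union measurableSet_Ioi (Set.Ioc_disjoint_Ioi le_rfl)]
    have h1 : ∫⁻ v in Set.Ioc 0 (c ^ 2), h v ≤ ENNReal.ofReal (c ^ 2) := by
      calc ∫⁻ v in Set.Ioc 0 (c ^ 2), h v ≤ ∫⁻ _ in Set.Ioc 0 (c ^ 2), 1 :=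
            lintegral_mono fun v => min_le_left _ _
        _ = ENNReal.ofReal (c ^ 2) := by simp
    have h2 : ∫⁻ v in Set.Ioi (c ^ 2), h v ≤ ENNReal.ofReal (2 * c ^ 2) := by
      calc ∫⁻ v in Set.Ioi (c ^ 2), h v
          ≤ ∫⁻ v in Set.Ioi (c ^ 2), ENNReal.ofReal (c ^ 3 * v ^ (-(3 / 2) : ℝ)) :=
            setLIntegral_mono' measurableSet_Ioi fun v hv => by
              rw [← hrpow v hv]; exact min_le_right _ _
        _ = ENNReal.ofReal (∫ v in Set.Ioi (c ^ 2), c ^ 3 * v ^ (-(3 / 2) : ℝ)) := by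
            rw [ofReal_integral_eq_lintegral_ofReal]
            · exact (integrableOn_Ioi_rpow_of_lt (by norm_num) hc2).const_mul _
            · refine (ae_restrict_iff' measurableSet_Ioi).2 (Eventually.of_forall fun v hv => ?_)
              have hv0 : 0 < v := hc2.trans hv
              positivity
        _ = ENNReal.ofReal (2 * c ^ 2) := by
            rw [integral_const_mul, integral_Ioi_rpow_of_lt (by norm_num) hc2]
            congr 1
            have : (c ^ 2) ^ (-(3 / 2) + 1 : ℝ) = c⁻¹ := by
              rw [← Real.rpow_natCast, ← Real.rpow_mul hc.le]
              norm_num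
              exact Real.rpow_neg_one c
            rw [this]
            field_simp
            norm_num
    calc _ ≤ ENNReal.ofReal (c ^ 2) + ENNReal.ofReal (2 * c ^ 2) := add_le_add h1 h2
      _ = ENNReal.ofReal (3 * c ^ 2) := by
        rw [← ENNReal.ofReal_add (by positivity) (by positivity)]; congr 1; ring
  calc ∫⁻ u in Set.Ioc s t, min 1 (ENNReal.ofReal ((c / √(u - s)) ^ 3))
      = ∫⁻ u in Set.Ioc s t, h (u - s) := rfl
    _ ≤ ∫⁻ u in Set.Ioi s, h (u - s) := lintegral_mono_set Set.Ioc_subset_Ioi_self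
    _ = ∫⁻ u, (Set.Ioi 0).indicator h (u - s) := by
      rw [← lintegral_indicator measurableSet_Ioi]
      congr 1 with u
      simp [Set.indicator]
    _ = ∫⁻ v in Set.Ioi 0, h v := by
      rw [lintegral_sub_right_eq_self, lintegral_indicator measurableSet_Ioi]
    _ ≤ ENNReal.ofReal (3 * c ^ 2) := hsplit

lemma IsWienerMeasure.lintegral_bump_le (hP : IsWienerMeasure P) {s u r : ℝ} (hs : 0 ≤ s)
    (hsu : s < u) (hr : 0 < r) (y : E3) :
    ∫⁻ ω, ENNReal.ofReal (bump r (ω u.toNNReal - ω s.toNNReal + y)) ∂P ≤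
      min 1 (ENNReal.ofReal ((2 * r / √(u - s)) ^ 3)) := by
  have := hP.isProbabilityMeasure
  refine le_min ?_ ?_
  · calc _ ≤ ∫⁻ _, 1 ∂P := lintegral_mono fun ω => by
          simpa using ENNReal.ofReal_le_ofReal (bump_le_one _ _)
      _ = 1 := by simp
  · have hm : MeasurableSet {ω : PathSpace | ‖ω u.toNNReal - ω s.toNNReal + y‖ < 2 * r} :=
      measurableSet_lt (((measurable_eval _).sub (measurable_eval _)).add_const y).norm
        measurable_const
    calc ∫⁻ ω, ENNReal.ofReal (bump r (ω u.toNNReal - ω s.toNNReal + y)) ∂P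
        ≤ ∫⁻ ω, Set.indicator {ω : PathSpace | ‖ω u.toNNReal - ω s.toNNReal + y‖ < 2 * r} 1 ω ∂P := by
          refine lintegral_mono fun ω => ?_
          by_cases h : bump r (ω u.toNNReal - ω s.toNNReal + y) = 0
          · simp [h]
          · have h' := norm_lt_of_bump_ne_zero hr h
            rw [Set.indicator_of_mem (by exact h')]
            simpa using ENNReal.ofReal_le_ofReal (bump_le_one _ _)
      _ = P {ω : PathSpace | ‖ω u.toNNReal - ω s.toNNReal + y‖ < 2 * r} :=
          lintegral_indicator_one hm
      _ ≤ _ := by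
          have h := hP.increment_ball_le ((Real.toNNReal_lt_toNNReal_iff (hs.trans_lt hsu)).2 hsu) y
            (r := 2 * r) (by positivity)
          rwa [Real.coe_toNNReal _ hs, Real.coe_toNNReal _ (hs.trans hsu.le)] at h

/-- The functional `expOcc` started at time `u`, as a function of the increments after `u`. -/
noncomputable def expOccShift (a r t u : ℝ) (z : E3) (ζ : PathSpace) : ℝ :=
  Real.exp (∫ v in u..t, a * bump r (ζ (v - u).toNNReal + z))

lemma measurable_expOccShift (a r t u : ℝ) :
    Measurable fun p : E3 × PathSpace => expOccShift a r t u p.1 p.2 := by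
  unfold expOccShift
  refine Real.measurable_exp.comp (measurable_intervalIntegral_left ?_ measurable_const t)
  have h1 : Measurable fun p : (E3 × PathSpace) × ℝ => p.1.2 (p.2 - u).toNNReal :=
    measurable_path_eval (measurable_snd.comp measurable_fst) (measurable_snd.sub_const u)
  exact ((continuous_bump r).measurable.comp
    (h1.add (measurable_fst.comp measurable_fst))).const_mul a

lemma expOccShift_shiftPath {a r t u : ℝ} (hu : 0 ≤ u) (hut : u ≤ t) (z : E3) (ω : PathSpace) :
    expOccShift a r t u z (shiftPath u.toNNReal ω) = expOcc a r t u z ω := by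
  unfold expOccShift expOcc
  congr 1
  refine intervalIntegral.integral_congr fun v hv => ?_
  rw [Set.uIcc_of_le hut] at hv
  have : u.toNNReal + (v - u).toNNReal = v.toNNReal := by
    rw [← Real.toNNReal_add hu (by linarith [hv.1])]
    congr 1; ring
  simp only [shiftPath_apply, this]

/-- Besides `exp_integral_eq`, this uses `ω v - ω s + y = (ω v - ω u) + (ω u - ω s + y)`: after time
`u` the functional is of the same kind, with a new displacement. -/
lemma ofReal_expOcc_eq {a r t s : ℝ} (ha : 0 ≤ a) (hst : s ≤ t) (y : E3) (ω : PathSpace) :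
    ENNReal.ofReal (expOcc a r t s y ω) = 1 + ENNReal.ofReal a * ∫⁻ u in Set.Ioc s t,
      ENNReal.ofReal (bump r (ω u.toNNReal - ω s.toNNReal + y)) *
        ENNReal.ofReal (expOcc a r t u (ω u.toNNReal - ω s.toNNReal + y) ω) := by
  have hv := continuous_occ_integrand a r s y ω
  have hF : Continuous fun u => a * bump r (ω u.toNNReal - ω s.toNNReal + y) *
      Real.exp (∫ u' in u..t, a * bump r (ω u'.toNNReal - ω s.toNNReal + y)) :=
    hv.mul (continuous_exp_integral hv t)
  have h0 : ∀ u, 0 ≤ a * bump r (ω u.toNNReal - ω s.toNNReal + y) *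
      Real.exp (∫ u' in u..t, a * bump r (ω u'.toNNReal - ω s.toNNReal + y)) := fun u =>
    mul_nonneg (mul_nonneg ha (bump_nonneg _ _)) (Real.exp_pos _).le
  rw [expOcc, exp_integral_eq hv, ENNReal.ofReal_add zero_le_one
    (intervalIntegral.integral_nonneg hst fun u _ => h0 u), ENNReal.ofReal_one,
    intervalIntegral.integral_of_le hst, ofReal_integral_eq_lintegral_ofReal
      ((hF.integrableOn_Icc).mono_set Set.Ioc_subset_Icc_self) (Eventually.of_forall h0),
    ← lintegral_const_mul' _ _ ENNReal.ofReal_ne_top]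
  congr 2 with u
  rw [ENNReal.ofReal_mul (mul_nonneg ha (bump_nonneg _ _)), ENNReal.ofReal_mul ha, mul_assoc]
  congr 3
  unfold expOcc
  congr 3 with v
  congr 2
  abel

/-- By independence the joint law is a product, so `Z` can be integrated first with `Y` frozen. -/
lemma lintegral_mul_le_of_indepFun {Ω α β : Type*} {mΩ : MeasurableSpace Ω}
    {mα : MeasurableSpace α} {mβ : MeasurableSpace β} {μ : Measure Ω} [IsProbabilityMeasure μ]
    {Y : Ω → α} {Z : Ω → β} (hY : Measurable Y) (hZ : Measurable Z) (hind : IndepFun Y Z μ)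
    {g : α → ℝ≥0∞} (hg : Measurable g) {F : α → β → ℝ≥0∞}
    (hF : Measurable fun p : α × β => F p.1 p.2) {K : ℝ≥0∞}
    (hK : ∀ z, ∫⁻ ω, F z (Z ω) ∂μ ≤ K) :
    ∫⁻ ω, g (Y ω) * F (Y ω) (Z ω) ∂μ ≤ K * ∫⁻ ω, g (Y ω) ∂μ := by
  have hF' : ∀ z, Measurable (F z) := fun z => hF.comp (measurable_const.prodMk measurable_id)
  have hG : Measurable fun p : α × β => g p.1 * F p.1 p.2 := (hg.comp measurable_fst).mul hF
  have : IsProbabilityMeasure (μ.map Z) := Measure.isProbabilityMeasure_map hZ.aemeasurable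
  calc ∫⁻ ω, g (Y ω) * F (Y ω) (Z ω) ∂μ
      = ∫⁻ p, g p.1 * F p.1 p.2 ∂(μ.map fun ω => (Y ω, Z ω)) :=
        (lintegral_map hG (hY.prodMk hZ)).symm
    _ = ∫⁻ p, g p.1 * F p.1 p.2 ∂((μ.map Y).prod (μ.map Z)) := by
        rw [(indepFun_iff_map_prod_eq_prod_map_map hY.aemeasurable hZ.aemeasurable).1 hind]
    _ = ∫⁻ z, ∫⁻ ζ, g z * F z ζ ∂(μ.map Z) ∂(μ.map Y) := lintegral_prod _ hG.aemeasurable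
    _ ≤ ∫⁻ z, g z * K ∂(μ.map Y) := by
        refine lintegral_mono fun z => ?_
        rw [lintegral_const_mul _ (hF' z), lintegral_map (hF' z) hZ]
        exact mul_le_mul_right (hK z) _
    _ = K * ∫⁻ ω, g (Y ω) ∂μ := by
        rw [lintegral_mul_const _ hg, lintegral_map hg hY, mul_comm]

/-- Conditioning on the path up to time `u`. -/
lemma IsWienerMeasure.lintegral_bump_mul_expOcc_le (hP : IsWienerMeasure P) {a r t s u : ℝ}
    (hs : 0 ≤ s) (hsu : s ≤ u) (hut : u ≤ t) (y : E3) {K : ℝ≥0∞}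
    (hK : ∀ z, ∫⁻ ω, ENNReal.ofReal (expOcc a r t u z ω) ∂P ≤ K) :
    ∫⁻ ω, ENNReal.ofReal (bump r (ω u.toNNReal - ω s.toNNReal + y)) *
        ENNReal.ofReal (expOcc a r t u (ω u.toNNReal - ω s.toNNReal + y) ω) ∂P ≤
      K * ∫⁻ ω, ENNReal.ofReal (bump r (ω u.toNNReal - ω s.toNNReal + y)) ∂P := by
  have := hP.isProbabilityMeasure
  have hu0 : 0 ≤ u := hs.trans hsu
  have hshift : ∀ z ω, ENNReal.ofReal (expOcc a r t u (z + y) ω) =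
      ENNReal.ofReal (expOccShift a r t u (z + y) (shiftPath u.toNNReal ω)) := fun z ω => by
    rw [expOccShift_shiftPath hu0 hut]
  rw [lintegral_congr fun ω => by rw [hshift]]
  exact lintegral_mul_le_of_indepFun
    (Y := fun ω : PathSpace => ω u.toNNReal - ω s.toNNReal) (Z := shiftPath u.toNNReal)
    (g := fun z => ENNReal.ofReal (bump r (z + y)))
    (F := fun z ζ => ENNReal.ofReal (expOccShift a r t u (z + y) ζ))
    ((measurable_eval _).sub (measurable_eval _)) (measurable_shiftPath _)
    (hP.indepFun_increment (Real.toNNReal_le_toNNReal hsu))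
    (((continuous_bump r).measurable).comp (measurable_id.add_const y)).ennreal_ofReal
    ((measurable_expOccShift a r t u).comp
      ((measurable_fst.add_const y).prodMk measurable_snd)).ennreal_ofReal
    fun z => by
      rw [← lintegral_congr fun ω => hshift z ω]
      exact hK (z + y)

/-- **Khasminskii's lemma**: exponential moments of the time spent by Brownian motion near its
starting point, uniformly in the time horizon. -/
lemma IsWienerMeasure.lintegral_expOcc_le (hP : IsWienerMeasure P) {a r t s : ℝ} (ha : 0 ≤ a)
    (hr : 0 < r) (har : 24 * a * r ^ 2 ≤ 1) (hs : 0 ≤ s) (hst : s ≤ t) (y : E3) :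
    ∫⁻ ω, ENNReal.ofReal (expOcc a r t s y ω) ∂P ≤ 2 := by
  have := hP.isProbabilityMeasure
  -- The supremum runs over starting times and displacements because restarting at `u` changes both.
  set K : ℝ≥0∞ := ⨆ s ∈ Set.Icc 0 t, ⨆ y, ∫⁻ ω, ENNReal.ofReal (expOcc a r t s y ω) ∂P with hK
  have hKle : ∀ s ∈ Set.Icc 0 t, ∀ y, ∫⁻ ω, ENNReal.ofReal (expOcc a r t s y ω) ∂P ≤ K :=
    fun s hs y => le_iSup₂_of_le s hs (le_iSup_of_le y le_rfl)
  -- Without finiteness, `K ≤ 1 + K/2` would say nothing.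
  have hfin : K ≠ ∞ := by
    refine ne_top_of_le_ne_top (ENNReal.ofReal_ne_top (r := Real.exp (a * t))) ?_
    refine iSup₂_le fun s hs => iSup_le fun y => ?_
    calc _ ≤ ∫⁻ _, ENNReal.ofReal (Real.exp (a * t)) ∂P := lintegral_mono fun ω =>
          ENNReal.ofReal_le_ofReal (expOcc_le ha r hs.1 hs.2 y ω)
      _ = _ := by simp
  have hmarkov : ∀ s ∈ Set.Icc 0 t, ∀ y, ∀ u ∈ Set.Ioc s t,
      ∫⁻ ω, ENNReal.ofReal (bump r (ω u.toNNReal - ω s.toNNReal + y)) *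
        ENNReal.ofReal (expOcc a r t u (ω u.toNNReal - ω s.toNNReal + y) ω) ∂P ≤
      K * min 1 (ENNReal.ofReal ((2 * r / √(u - s)) ^ 3)) := fun s hs y u hu =>
    (hP.lintegral_bump_mul_expOcc_le hs.1 hu.1.le hu.2 y (hKle u ⟨hs.1.trans hu.1.le, hu.2⟩)).trans
      (mul_le_mul_right (hP.lintegral_bump_le hs.1 hu.1 hr y) _)
  -- The time integral of the ball probabilities is at most `3(2r)^2`, and `24 a r^2 ≤ 1` turns the
  -- factor `12 a r^2` into at most `1/2`.
  have hstep : ∀ s ∈ Set.Icc 0 t, ∀ y,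
      ∫⁻ ω, ENNReal.ofReal (expOcc a r t s y ω) ∂P ≤ 1 + K / 2 := by
    intro s hs y
    simp_rw [ofReal_expOcc_eq ha hs.2 y]
    have hm1 : Measurable fun p : PathSpace × ℝ => p.1 p.2.toNNReal - p.1 s.toNNReal + y :=
      ((measurable_path_eval measurable_fst measurable_snd).sub
        ((measurable_eval _).comp measurable_fst)).add_const y
    have hm : Measurable fun p : PathSpace × ℝ =>
        ENNReal.ofReal (bump r (p.1 p.2.toNNReal - p.1 s.toNNReal + y)) *
        ENNReal.ofReal (expOcc a r t p.2 (p.1 p.2.toNNReal - p.1 s.toNNReal + y) p.1) :=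
      ((continuous_bump r).measurable.comp hm1).ennreal_ofReal.mul
        (measurable_expOcc a r t measurable_snd hm1 measurable_fst).ennreal_ofReal
    rw [lintegral_add_left measurable_const, lintegral_const, measure_univ, mul_one,
      lintegral_const_mul' _ _ ENNReal.ofReal_ne_top, lintegral_lintegral_swap hm.aemeasurable]
    refine add_le_add_right ?_ 1
    calc _ ≤ ENNReal.ofReal a * ∫⁻ u in Set.Ioc s t,
            K * min 1 (ENNReal.ofReal ((2 * r / √(u - s)) ^ 3)) :=
          mul_le_mul_right (setLIntegral_mono' measurableSet_Ioc fun u hu => hmarkov s hs y u hu) _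
      _ ≤ ENNReal.ofReal a * (K * ENNReal.ofReal (3 * (2 * r) ^ 2)) := by
          rw [lintegral_const_mul' _ _ hfin]
          exact mul_le_mul_right (mul_le_mul_right (lintegral_min_one_le (by positivity) s t) _) _
      _ = K * ENNReal.ofReal (12 * a * r ^ 2) := by
          rw [mul_left_comm, ← ENNReal.ofReal_mul ha]
          congr 2; ring
      _ ≤ K * ENNReal.ofReal (1 / 2) :=
          mul_le_mul_right (ENNReal.ofReal_le_ofReal (by linarith)) _
      _ = K / 2 := by
          rw [one_div, ENNReal.ofReal_inv_of_pos two_pos, ENNReal.ofReal_ofNat, div_eq_mul_inv]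
  have hK2 : K ≤ 1 + K / 2 := iSup₂_le fun s hs => iSup_le fun y => hstep s hs y
  refine (hKle s ⟨hs, hst⟩ y).trans ?_
  clear_value K
  clear hstep hmarkov hKle hK
  lift K to ℝ≥0 using hfin
  have : (K : ℝ≥0∞) / 2 = ((K / 2 : ℝ≥0) : ℝ≥0∞) := by simp
  rw [this] at hK2
  have h3 : K ≤ 1 + K / 2 := by exact_mod_cast hK2
  have h4 : K ≤ 2 := by
    rw [← NNReal.coe_le_coe] at h3 ⊢
    push_cast at h3 ⊢
    linarith
  exact_mod_cast h4

/-! ### Dyadic decomposition of the Coulomb kernel. -/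

lemma Lambda_eq (ω : PathSpace) (t : ℝ) (x : E3) :
    Lambda ω t x = (ENNReal.ofReal t)⁻¹ * ∫⁻ s in Set.Icc 0 t, (‖ω s.toNNReal - x‖ₑ)⁻¹ := by
  rw [Lambda, coulomb, occupationMeasure, lintegral_smul_measure, smul_eq_mul,
    lintegral_map (by fun_prop) (continuous_path ω).measurable]
  simp_rw [← enorm_neg (x - _), neg_sub]

/-- Dyadic decomposition of the Coulomb kernel. -/
lemma inv_enorm_le_tsum_bump {R : ℝ} (hR : 0 < R) (y : E3) :
    (‖y‖ₑ)⁻¹ ≤ ENNReal.ofReal (1 / R) +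
      ∑' k : ℕ, ENNReal.ofReal (2 ^ (k + 1) / R) * ENNReal.ofReal (bump (R / 2 ^ k) y) := by
  have hterm : ∀ k : ℕ, ‖y‖ ≤ R / 2 ^ k → ENNReal.ofReal (2 ^ (k + 1) / R) ≤
      ENNReal.ofReal (1 / R) +
      ∑' k : ℕ, ENNReal.ofReal (2 ^ (k + 1) / R) * ENNReal.ofReal (bump (R / 2 ^ k) y) := by
    intro k hk
    refine le_add_left (le_trans ?_ (ENNReal.le_tsum k))
    rw [bump_eq_one (by positivity) hk]
    simp
  rcases eq_or_lt_of_le (norm_nonneg y) with h0 | h0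
  -- At `y = 0` every bump equals `1`, so the unbounded weights force the sum to be `∞`.
  · refine le_of_le_of_eq le_top (Eq.symm (ENNReal.eq_top_of_forall_nnreal_le fun M => ?_))
    obtain ⟨n, hn⟩ := pow_unbounded_of_one_lt ((M : ℝ) * R) (one_lt_two (α := ℝ))
    refine le_trans ?_ (hterm n (by rw [← h0]; positivity))
    rw [← ENNReal.ofReal_coe_nnreal]
    refine ENNReal.ofReal_le_ofReal ((le_div_iff₀ hR).2 ?_)
    rw [pow_succ]
    linarith [show (0 : ℝ) ≤ 2 ^ n by positivity]
  · rw [← ofReal_norm, ← ENNReal.ofReal_inv_of_pos h0]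
    rcases le_or_gt R ‖y‖ with h | h
    · refine le_add_right (ENNReal.ofReal_le_ofReal ?_)
      rw [one_div]
      exact inv_anti₀ hR h
    · obtain ⟨n, hn1, hn2⟩ := exists_nat_pow_near ((one_le_div h0).2 h.le) (one_lt_two (α := ℝ))
      refine le_trans (ENNReal.ofReal_le_ofReal ?_) (hterm n ?_)
      · rw [le_div_iff₀ hR, inv_mul_eq_div]
        exact hn2.le
      · rw [le_div_iff₀ h0] at hn1
        rw [le_div_iff₀ (by positivity)]
        linarith

/-- If the supremum of the Coulomb functional is large, then the path spends a long time in a ball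
of some dyadic radius. -/
lemma exists_occupation_of_lt_supNorm {b t : ℝ} (hb : 0 < b) (ht : 0 < t) {ω : PathSpace}
    (h : ENNReal.ofReal b < supNorm ω t) :
    ∃ k : ℕ, ∃ x : E3, t / 8 * (3 / 8) ^ k <
      ∫ s in (0 : ℝ)..t, bump (2 / b / 2 ^ k) (ω s.toNNReal - x) := by
  obtain ⟨x, hx⟩ := lt_iSup_iff.1 h
  have hR : 0 < 2 / b := by positivity
  by_contra! hcon
  have hcont : ∀ k : ℕ, Continuous fun s : ℝ => bump (2 / b / 2 ^ k) (ω s.toNNReal - x) := by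
    intro k
    have := continuous_bump (2 / b / 2 ^ k)
    fun_prop
  have hocc : ∀ k : ℕ, ∫⁻ s in Set.Icc 0 t, ENNReal.ofReal (bump (2 / b / 2 ^ k)
      (ω s.toNNReal - x)) ≤ ENNReal.ofReal (t / 8 * (3 / 8) ^ k) := by
    intro k
    rw [← ofReal_integral_eq_lintegral_ofReal ((hcont k).integrableOn_Icc)
      (Eventually.of_forall fun s => bump_nonneg _ _), integral_Icc_eq_integral_Ioc,
      ← intervalIntegral.integral_of_le ht.le]
    exact ENNReal.ofReal_le_ofReal (hcon k x)
  -- The ratio `3/8` lies below `1/2`, so the weighted sum converges, and above `1/4`, so that the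
  -- exponents `4^k (3/8)^k` grow later. The factor `t/8` makes the total exactly `bt/2`.
  have hsum : ∑' k : ℕ, ENNReal.ofReal (2 ^ (k + 1) / (2 / b)) *
      ENNReal.ofReal (t / 8 * (3 / 8) ^ k) = ENNReal.ofReal (b * t / 2) := by
    have hg : Summable fun k : ℕ => b * t / 8 * (3 / 4 : ℝ) ^ k :=
      (summable_geometric_of_lt_one (by norm_num) (by norm_num)).mul_left _
    rw [tsum_congr fun k : ℕ => show _ = ENNReal.ofReal (b * t / 8 * (3 / 4 : ℝ) ^ k) by
      rw [← ENNReal.ofReal_mul (by positivity)]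
      congr 1
      rw [show (3 / 4 : ℝ) = 2 * (3 / 8) by norm_num, mul_pow, pow_succ]
      field_simp,
      ← ENNReal.ofReal_tsum_of_nonneg (fun k => by positivity) hg, tsum_mul_left,
      tsum_geometric_of_lt_one (by norm_num) (by norm_num)]
    congr 1
    norm_num
    ring
  have hle : ∫⁻ s in Set.Icc 0 t, (‖ω s.toNNReal - x‖ₑ)⁻¹ ≤ ENNReal.ofReal (b * t) := by
    calc ∫⁻ s in Set.Icc 0 t, (‖ω s.toNNReal - x‖ₑ)⁻¹
        ≤ ∫⁻ s in Set.Icc 0 t, (ENNReal.ofReal (1 / (2 / b)) +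
          ∑' k : ℕ, ENNReal.ofReal (2 ^ (k + 1) / (2 / b)) *
            ENNReal.ofReal (bump (2 / b / 2 ^ k) (ω s.toNNReal - x))) :=
          lintegral_mono fun s => inv_enorm_le_tsum_bump hR _
      _ = ENNReal.ofReal (1 / (2 / b)) * ENNReal.ofReal t +
          ∑' k : ℕ, ENNReal.ofReal (2 ^ (k + 1) / (2 / b)) * ∫⁻ s in Set.Icc 0 t,
            ENNReal.ofReal (bump (2 / b / 2 ^ k) (ω s.toNNReal - x)) := by
          rw [lintegral_add_left measurable_const, setLIntegral_const, Real.volume_Icc, sub_zero,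
            lintegral_tsum fun k => ((hcont k).measurable.ennreal_ofReal.const_mul _).aemeasurable]
          congr 2 with k
          rw [lintegral_const_mul _ (hcont k).measurable.ennreal_ofReal]
      _ ≤ ENNReal.ofReal (b * t / 2) + ∑' k : ℕ, ENNReal.ofReal (2 ^ (k + 1) / (2 / b)) *
            ENNReal.ofReal (t / 8 * (3 / 8) ^ k) := by
          refine add_le_add (le_of_eq ?_)
            (ENNReal.tsum_le_tsum fun k => mul_le_mul_right (hocc k) _)
          rw [← ENNReal.ofReal_mul (by positivity)]
          congr 1
          field_simp
      _ = ENNReal.ofReal (b * t) := by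
          rw [hsum, ← ENNReal.ofReal_add (by positivity) (by positivity)]
          congr 1
          ring
  refine hx.not_ge ?_
  rw [Lambda_eq, mul_comm, ← div_eq_mul_inv]
  refine ENNReal.div_le_of_le_mul ?_
  rwa [← ENNReal.ofReal_mul hb.le]

/-! ### Exponential tail bounds and summation over scales. -/

/-- Tail bound for the maximal time spent in a ball of given radius. -/
lemma IsWienerMeasure.measure_occupation_le (hP : IsWienerMeasure P) {a r t : ℝ} (ha : 0 ≤ a)
    (hr : 0 < r) (har : 384 * a * r ^ 2 ≤ 1) (ht : 0 ≤ t) (c : ℝ) :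
    P {ω | ∃ x : E3, c < ∫ s in (0 : ℝ)..t, bump r (ω s.toNNReal - x)} ≤
      ENNReal.ofReal ((1 + 2 * a * t) * Real.exp (-(a * c))) := by
  have := hP.isProbabilityMeasure
  let Z : PathSpace → ℝ≥0∞ := fun ω =>
    1 + ENNReal.ofReal a * ∫⁻ s in Set.Ioc 0 t, ENNReal.ofReal (expOcc a (4 * r) t s 0 ω)
  have hm : Measurable fun p : PathSpace × ℝ => ENNReal.ofReal (expOcc a (4 * r) t p.2 0 p.1) :=
    (measurable_expOcc a (4 * r) t measurable_snd measurable_const measurable_fst).ennreal_ofReal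
  have hZ : Measurable Z := (hm.lintegral_prod_right'.const_mul _).const_add _
  have hEZ : ∫⁻ ω, Z ω ∂P ≤ ENNReal.ofReal (1 + 2 * a * t) := by
    rw [lintegral_add_left measurable_const, lintegral_const, measure_univ, mul_one,
      lintegral_const_mul' _ _ ENNReal.ofReal_ne_top, lintegral_lintegral_swap hm.aemeasurable,
      ENNReal.ofReal_add zero_le_one (by positivity), ENNReal.ofReal_one]
    refine add_le_add_right ?_ 1
    calc _ ≤ ENNReal.ofReal a * ∫⁻ _ in Set.Ioc 0 t, 2 := by
          refine mul_le_mul_right (setLIntegral_mono' measurableSet_Ioc fun s hs => ?_) _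
          -- The radius is now `4r`, and `24 a (4r)^2 = 384 a r^2`.
          exact hP.lintegral_expOcc_le ha (by positivity) (by linarith) hs.1.le hs.2 0
      _ = ENNReal.ofReal (2 * a * t) := by
          rw [setLIntegral_const, Real.volume_Ioc, sub_zero, ← ENNReal.ofReal_ofNat,
            ← ENNReal.ofReal_mul zero_le_two, ← ENNReal.ofReal_mul ha]
          congr 1; ring
  have hsub : {ω : PathSpace | ∃ x : E3, c < ∫ s in (0 : ℝ)..t, bump r (ω s.toNNReal - x)} ⊆
      {ω | ENNReal.ofReal (Real.exp (a * c)) ≤ Z ω} := by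
    rintro ω ⟨x, hx⟩
    refine le_trans (ENNReal.ofReal_le_ofReal (Real.exp_le_exp.2 ?_))
      (exp_occupation_le ha hr ht ω x)
    rw [intervalIntegral.integral_const_mul]
    exact mul_le_mul_of_nonneg_left hx.le ha
  calc _ ≤ P {ω | ENNReal.ofReal (Real.exp (a * c)) ≤ Z ω} := measure_mono hsub
    _ ≤ (∫⁻ ω, Z ω ∂P) / ENNReal.ofReal (Real.exp (a * c)) :=
      meas_ge_le_lintegral_div hZ.aemeasurable (by simp [Real.exp_pos]) ENNReal.ofReal_ne_top
    _ ≤ ENNReal.ofReal (1 + 2 * a * t) / ENNReal.ofReal (Real.exp (a * c)) := by gcongr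
    _ = _ := by
      rw [← ENNReal.ofReal_div_of_pos (Real.exp_pos _), Real.exp_neg, div_eq_mul_inv]

/-- Bernoulli gives `(3/2)^k ≥ 1 + k/2`. Since `αt ≥ 14`, each extra `exp (-αt/2)` is at most `1/8`,
so it absorbs a factor `4` and leaves `1/2`. -/
lemma tail_term_le {A α t : ℝ} (hA : 0 ≤ A) (hα : 0 < α) (ht : 14 / α ≤ t) (k : ℕ) :
    (1 + 2 * (A * 4 ^ k) * t) * Real.exp (-(α * t * (3 / 2) ^ k)) ≤
      (1 + 2 * A * t) * Real.exp (-(α * t)) * (1 / 2) ^ k := by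
  have hαt : 14 ≤ α * t := by rwa [div_le_iff₀' hα] at ht
  have ht0 : 0 ≤ t := (by positivity : 0 ≤ 14 / α).trans ht
  have h4 : (1 : ℝ) ≤ 4 ^ k := one_le_pow₀ (by norm_num)
  have hbern : 1 + k * (1 / 2 : ℝ) ≤ (3 / 2) ^ k := by
    have := one_add_mul_le_pow (show (-2 : ℝ) ≤ 1 / 2 by norm_num) k
    rwa [show (1 : ℝ) + 1 / 2 = 3 / 2 by norm_num] at this
  have hexp : Real.exp (-(α * t / 2)) ≤ 1 / 8 := by
    rw [Real.exp_neg, one_div]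
    refine inv_anti₀ (by norm_num) ?_
    linarith [Real.add_one_le_exp (α * t / 2)]
  calc (1 + 2 * (A * 4 ^ k) * t) * Real.exp (-(α * t * (3 / 2) ^ k))
      ≤ ((1 + 2 * A * t) * 4 ^ k) * Real.exp (-(α * t) + k * -(α * t / 2)) := by
        refine mul_le_mul ?_ (Real.exp_le_exp.2 ?_) (Real.exp_pos _).le (by positivity)
        · linarith
        · nlinarith [mul_le_mul_of_nonneg_left hbern (by linarith : 0 ≤ α * t)]
    _ = (1 + 2 * A * t) * Real.exp (-(α * t)) * (4 * Real.exp (-(α * t / 2))) ^ k := by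
        rw [Real.exp_add, Real.exp_nat_mul, mul_pow]; ring
    _ ≤ _ := by
        gcongr
        linarith

/-- Exponential tail bound for the supremum of the Coulomb functional. -/
lemma IsWienerMeasure.exists_measure_supNorm_le (hP : IsWienerMeasure P) {b : ℝ} (hb : 0 < b) :
    ∃ c > 0, ∀ᶠ t : ℝ in atTop,
      P {ω | ENNReal.ofReal b < supNorm ω t} ≤ ENNReal.ofReal (Real.exp (-(c * t))) := by
  -- With `a = A 4^k` and `r = 2/(b 2^k)`, this is the value for which `384 a r^2 = 1` at every
  -- scale; `α = A/8` comes from the threshold `t/8`.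
  set A : ℝ := b ^ 2 / 1536 with hA
  set α : ℝ := A / 8 with hα
  have hA0 : 0 < A := by positivity
  have hα0 : 0 < α := by positivity
  refine ⟨α / 2, by positivity, ?_⟩
  -- The first threshold is that of `tail_term_le`; the second gives `4At ≤ (αt)^2/8`, so that the
  -- quadratic lower bound for `exp (αt/2)` absorbs the prefactor `2(1 + 2At)` at the cost of half
  -- the rate.
  filter_upwards [eventually_ge_atTop (14 / α), eventually_ge_atTop (32 * A / α ^ 2)] with t h1 h2
  have ht : 0 < t := lt_of_lt_of_le (by positivity) h1
  have hsub : {ω : PathSpace | ENNReal.ofReal b < supNorm ω t} ⊆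
      ⋃ k : ℕ, {ω | ∃ x : E3, t / 8 * (3 / 8) ^ k <
        ∫ s in (0 : ℝ)..t, bump (2 / b / 2 ^ k) (ω s.toNNReal - x)} := fun ω hω =>
    Set.mem_iUnion.2 (exists_occupation_of_lt_supNorm hb ht hω)
  have hterm : ∀ k : ℕ, P {ω | ∃ x : E3, t / 8 * (3 / 8) ^ k <
        ∫ s in (0 : ℝ)..t, bump (2 / b / 2 ^ k) (ω s.toNNReal - x)} ≤
      ENNReal.ofReal ((1 + 2 * A * t) * Real.exp (-(α * t)) * (1 / 2) ^ k) := by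
    intro k
    have h2k : ((2 : ℝ) ^ k) ^ 2 = 4 ^ k := by rw [← pow_mul, mul_comm, pow_mul]; norm_num
    refine (hP.measure_occupation_le (a := A * 4 ^ k) (by positivity) (by positivity) ?_ ht.le
      _).trans (ENNReal.ofReal_le_ofReal (le_of_eq_of_le ?_ (tail_term_le hA0.le hα0 h1 k)))
    · rw [div_pow, h2k, hA]
      refine le_of_eq ?_
      field_simp
      norm_num
    · congr 3
      rw [show (3 / 2 : ℝ) = 4 * (3 / 8) by norm_num, mul_pow, hα]
      ring
  have hgeom : Summable fun k : ℕ =>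
      (1 + 2 * A * t) * Real.exp (-(α * t)) * (1 / 2 : ℝ) ^ k :=
    summable_geometric_two.mul_left _
  calc P {ω | ENNReal.ofReal b < supNorm ω t}
      ≤ ∑' k : ℕ, ENNReal.ofReal ((1 + 2 * A * t) * Real.exp (-(α * t)) * (1 / 2) ^ k) :=
        (measure_mono hsub).trans ((measure_iUnion_le _).trans (ENNReal.tsum_le_tsum hterm))
    _ = ENNReal.ofReal ((1 + 2 * A * t) * Real.exp (-(α * t)) * 2) := by
        rw [← ENNReal.ofReal_tsum_of_nonneg (fun k => by positivity) hgeom, tsum_mul_left,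
          tsum_geometric_two]
    _ ≤ ENNReal.ofReal (Real.exp (-(α / 2 * t))) := by
        refine ENNReal.ofReal_le_ofReal ?_
        have hq := Real.quadratic_le_exp_of_nonneg (x := α * t / 2) (by positivity)
        have h1' : 14 ≤ α * t := by rwa [div_le_iff₀' hα0] at h1
        have h2' : 32 * A * t ≤ (α * t) ^ 2 := by
          rw [div_le_iff₀' (by positivity)] at h2
          nlinarith
        have hpoly : (1 + 2 * A * t) * 2 ≤ Real.exp (α * t / 2) := by nlinarith
        calc (1 + 2 * A * t) * Real.exp (-(α * t)) * 2
            = (1 + 2 * A * t) * 2 * Real.exp (-(α * t)) := by ring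
          _ ≤ Real.exp (α * t / 2) * Real.exp (-(α * t)) := by gcongr
          _ = Real.exp (-(α / 2 * t)) := by rw [← Real.exp_add]; congr 1; ring

end BrownianCoulomb

theorem corollary1p4 (P : Measure BrownianCoulomb.PathSpace)
    (hP : BrownianCoulomb.IsWienerMeasure P) (b : ℝ) (hb : 0 < b) :
    limsup (fun t : ℝ =>
        ((1 / t : ℝ) : EReal) *
          ENNReal.log (P {ω | ENNReal.ofReal b < BrownianCoulomb.supNorm ω t})) atTop
      < 0 := by
  obtain ⟨c, hc, h⟩ := hP.exists_measure_supNorm_le hb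
  refine lt_of_le_of_lt (b := ((-c : ℝ) : EReal)) (limsup_le_of_le (by isBoundedDefault) ?_)
    (by exact_mod_cast neg_lt_zero.2 hc)
  filter_upwards [h, eventually_gt_atTop 0] with t ht ht0
  calc ((1 / t : ℝ) : EReal) *
          ENNReal.log (P {ω | ENNReal.ofReal b < BrownianCoulomb.supNorm ω t})
      ≤ ((1 / t : ℝ) : EReal) * ((-(c * t) : ℝ) : EReal) := by
        refine mul_le_mul_of_nonneg_left ?_ (by exact_mod_cast (by positivity : 0 ≤ 1 / t))
        refine (ENNReal.log_le_log ht).trans_eq ?_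
        rw [ENNReal.log_ofReal_of_pos (Real.exp_pos _), Real.log_exp]
    _ = ((-c : ℝ) : EReal) := by
        rw [← EReal.coe_mul]
        congr 1
        field_simp
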